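/- **Proposition 6.3.** Let $p$ be a prime and let $q=p^f$ with $f\ge 1$, where $f\ge 2$ if $p=2$. Let $\Gamma=(\mathcal V,\mathcal E)$ be a digraph: $\mathcal V$ is a finite set and $\mathcal E\subseteq\mathcal V\times\mathcal V\smallsetminus\{(x,x)\mid x\in\mathcal V\}$. A pair $(x,y)\in\mathcal E$ is called a directed edge if $(y,x)\notin\mathcal E$, and $x,y$ are joined by an undirected edge if $(x,y),(y,x)\in\mathcal E$. Let $G$ be the oriented right-angled Artin pro-$p$ group associated to $\Gamma$ and $q$, that is, the quotient of the free pro-$p$ group on $\mathcal V$ by the closed normal subgroup generated by the elements $[x,y]$ for every undirected edge joining $x$ and $y$, and $[y,x]x^{-q}$ for every directed edge $(x,y)$, where $[a,b]=aba^{-1}b^{-1}$. For $x\in\mathcal V$ let $x^\ast\in \mathrm H^1(G,\mathbb F_p)=\mathrm{Hom}(G,\mathbb F_p)$ be the continuous homomorphism with $x^\ast(x)=1$ and $x^\ast(y)=0$ for every vertex $y\ne x$. Suppose that $\Gamma$ has vertices $u,v,w$ such that $(u,w)$ is a directed edge; $u$ and $v$ are adjacent (at least one of $(u,v),(v,u)$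 belongs to $\mathcal E$); and either $(w,v)$ is a directed edge or $w$ and $v$ are joined by an undirected edge. Put $\alpha=u^\ast+v^\ast$. Then the $q$-fold Massey product $$\langle\underbrace{\alpha,\ldots,\alpha}_{q\text{ times}}\rangle\subseteq \mathrm H^2(G,\mathbb F_p)$$ is essential, i.e., it is non-empty and does not contain $0$. Here, for $n\ge 2$ and $\alpha_1,\dots,\alpha_n\in\mathrm H^1(G,\mathbb F_p)$, the Massey product $\langle\alpha_1,\ldots,\alpha_n\rangle$ is the set of the classes in $\mathrm H^2(G,\mathbb F_p)$ of the 2-cocycles $\sum_{0<r<n}a_{0,r}\smallsmile a_{r,n}$, where $(a_{i,j})$, $0\le i<j\le n$, $(i,j)\ne(0,n)$, runs through the families of continuous 1-cochains $G\to\mathbb F_p$ such that $a_{i-1,i}=\alpha_i$ for $1\le i\le n$ and $\partial a_{i,j}=\sum_{i<r<j}a_{i,r}\smallsmile a_{r,j}$ for all such $i,j$ (with $(\partial a)(g,h)=a(h)-a(gh)+a(g)$ and $(a\smallsmile b)(g,h)=a(g)b(h)$). -/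

import Mathlib

/-! ### Digraphs -/

namespace Digraph

variable {V : Type*}

/-- `(x, y)` is a directed edge: `(x, y)` is an edge and `(y, x)` is not. -/
def IsDirectedEdge (Γ : Digraph V) (x y : V) : Prop := Γ.Adj x y ∧ ¬ Γ.Adj y x

/-- `x` and `y` are joined by an undirected edge: both `(x, y)` and `(y, x)` are edges. -/
def IsUndirectedEdge (Γ : Digraph V) (x y : V) : Prop := Γ.Adj x y ∧ Γ.Adj y x

/-- `x` and `y` are adjacent: at least one of `(x, y)` and `(y, x)` is an edge. -/
def IsJoined (Γ : Digraph V) (x y : V) : Prop := Γ.Adj x y ∨ Γ.Adj y x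

end Digraph

/-! ### The free pro-`p` group on a finite set -/

/-- The normal subgroups of `p`-power index of the free group on `V`. -/
def PPowerIndexSubgroup (p : ℕ) (V : Type*) : Type _ :=
  {N : Subgroup (FreeGroup V) // N.Normal ∧ ∃ k : ℕ, N.index = p ^ k}

namespace PPowerIndexSubgroup

variable {p : ℕ} {V : Type*}

instance (N : PPowerIndexSubgroup p V) : N.1.Normal := N.2.1

/-- The finite quotients `FreeGroup V ⧸ N` carry the discrete topology. -/
instance (N : PPowerIndexSubgroup p V) : TopologicalSpace (FreeGroup V ⧸ N.1) := ⊥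

instance (N : PPowerIndexSubgroup p V) : DiscreteTopology (FreeGroup V ⧸ N.1) := ⟨rfl⟩

end PPowerIndexSubgroup

/-- The free pro-`p` group on the finite set `V`, with the topology induced from the product:
the inverse limit of the (discrete, finite) quotients of the free group on `V` by its normal
subgroups of `p`-power index, as a subgroup of the product of these quotients. -/
def FreeProP (p : ℕ) (V : Type*) :
    Subgroup ((N : PPowerIndexSubgroup p V) → FreeGroup V ⧸ N.1) where
  carrier := {x | ∀ (M N : PPowerIndexSubgroup p V) (h : M.1 ≤ N.1),
    QuotientGroup.map M.1 N.1 (MonoidHom.id _) h (x M) = x N}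
  mul_mem' {x y} hx hy M N h := by
    simp only [Pi.mul_apply, map_mul, hx M N h, hy M N h]
  one_mem' M N h := by simp only [Pi.one_apply, map_one]
  inv_mem' {x} hx M N h := by simp only [Pi.inv_apply, map_inv, hx M N h]

namespace FreeProP

variable {p : ℕ} {V : Type*}

/-- The canonical map from the free group to the free pro-`p` group. -/
def ofFreeGroup (p : ℕ) (V : Type*) : FreeGroup V →* FreeProP p V where
  toFun x := ⟨fun N => QuotientGroup.mk' N.1 x, fun _ _ _ => rfl⟩
  map_one' := rfl
  map_mul' _ _ := rfl

/-- The free generator attached to `x : V`. -/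
def of (p : ℕ) {V : Type*} (x : V) : FreeProP p V := ofFreeGroup p V (FreeGroup.of x)

/-- The continuous projection of the free pro-`p` group onto `FreeGroup V ⧸ N`. -/
def proj (N : PPowerIndexSubgroup p V) : FreeProP p V →ₜ* FreeGroup V ⧸ N.1 where
  toFun x := x.1 N
  map_one' := rfl
  map_mul' _ _ := rfl
  continuous_toFun := (continuous_apply N).comp continuous_subtype_val

end FreeProP

/-! ### Oriented pro-`p` RAAGs -/

section RAAG

variable {V : Type*}

/-- The defining relators, in the free pro-`p` group: `[x, y]` for each undirected edge, and
`[y, x] x⁻ᵠ` for each directed edge `(x, y)`, where `[a, b] = a b a⁻¹ b⁻¹`. -/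
def orientedRelators (p q : ℕ) (Γ : Digraph V) : Set (FreeProP p V) :=
  {r | ∃ x y, Γ.IsUndirectedEdge x y ∧
    r = FreeProP.of p x * FreeProP.of p y * (FreeProP.of p x)⁻¹ * (FreeProP.of p y)⁻¹} ∪
  {r | ∃ x y, Γ.IsDirectedEdge x y ∧
    r = FreeProP.of p y * FreeProP.of p x * (FreeProP.of p y)⁻¹ * (FreeProP.of p x)⁻¹ *
      (FreeProP.of p x ^ q)⁻¹}

/-- The closed normal subgroup generated by the relators. -/
def orientedRelations (p q : ℕ) (Γ : Digraph V) : Subgroup (FreeProP p V) :=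
  (Subgroup.normalClosure (orientedRelators p q Γ)).topologicalClosure

instance (p q : ℕ) (Γ : Digraph V) : (orientedRelations p q Γ).Normal :=
  Subgroup.is_normal_topologicalClosure _

/-- The oriented right-angled Artin pro-`p` group associated to `Γ` and `q`, with the quotient
topology. -/
abbrev OrientedRAAG (p q : ℕ) (Γ : Digraph V) : Type _ :=
  FreeProP p V ⧸ orientedRelations p q Γ

/-- The element of the oriented pro-`p` RAAG given by a vertex. -/
def OrientedRAAG.vertex (p q : ℕ) (Γ : Digraph V) (x : V) : OrientedRAAG p q Γ :=
  QuotientGroup.mk (FreeProP.of p x)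

end RAAG

/-! ### `𝔽_p`-cohomology in degrees 1 and 2 and Massey products

Cochains are continuous inhomogeneous cochains with values in the trivial discrete module
`ZMod p`. -/

section Cohomology

variable (p : ℕ) (G : Type*) [Group G] [TopologicalSpace G] [IsTopologicalGroup G]

/-- The coboundary `C¹(G) → C²(G)`, `(∂a)(g, h) = a(h) - a(gh) + a(g)`. -/
def cobd1 : C(G, ZMod p) →+ C(G × G, ZMod p) where
  toFun a := ⟨fun x => a x.2 - a (x.1 * x.2) + a x.1, by fun_prop⟩
  map_zero' := by ext; simp
  map_add' a b := by ext; simp; ring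

/-- The coboundary `C²(G) → C³(G)`,
`(∂c)(g, h, k) = c(h, k) - c(gh, k) + c(g, hk) - c(g, h)`. -/
def cobd2 : C(G × G, ZMod p) →+ C(G × G × G, ZMod p) where
  toFun c := ⟨fun x => c (x.2.1, x.2.2) - c (x.1 * x.2.1, x.2.2) + c (x.1, x.2.1 * x.2.2)
    - c (x.1, x.2.1), by fun_prop⟩
  map_zero' := by ext; simp
  map_add' a b := by ext; simp; ring

/-- `H¹(G, 𝔽_p)`: the 1-cocycles, that is, the continuous homomorphisms from `G` to the additive
group `ZMod p` (the action is trivial, so every 1-coboundary is zero). -/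
abbrev H1 : Type _ := (cobd1 p G).ker

/-- `H²(G, 𝔽_p)`: the 2-cocycles modulo the 2-coboundaries. -/
abbrev H2 : Type _ := (cobd2 p G).ker ⧸ (cobd1 p G).range.addSubgroupOf (cobd2 p G).ker

variable {p G}

/-- The cup product of two 1-cochains, `(a ⌣ b)(g, h) = a(g) b(h)`. -/
def cup (a b : C(G, ZMod p)) : C(G × G, ZMod p) := ⟨fun x => a x.1 * b x.2, by fun_prop⟩

/-- A defining system for the `n`-fold Massey product `⟨α₁, …, αₙ⟩` is an array of 1-cochains
`a i j` (only the entries with `0 ≤ i < j ≤ n` and `(i, j) ≠ (0, n)` matter) such that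
`a (i-1) i` represents `αᵢ` and `∂ (a i j) = ∑_{i < r < j} a i r ⌣ a r j`. -/
structure IsDefiningSystem {n : ℕ} (α : Fin n → H1 p G)
    (a : Fin (n + 1) → Fin (n + 1) → C(G, ZMod p)) : Prop where
  diag : ∀ i : Fin n, a i.castSucc i.succ = α i
  cobd : ∀ i j : Fin (n + 1), i < j → (i, j) ≠ (0, Fin.last n) →
    cobd1 p G (a i j) = ∑ r ∈ Finset.Ioo i j, cup (a i r) (a r j)

/-- The 2-cochain attached to a defining system. -/
def masseyCochain {n : ℕ} (a : Fin (n + 1) → Fin (n + 1) → C(G, ZMod p)) : C(G × G, ZMod p) :=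
  ∑ r ∈ Finset.Ioo 0 (Fin.last n), cup (a 0 r) (a r (Fin.last n))

theorem cobd2_cup (a b : C(G, ZMod p)) (g h k : G) :
    cobd2 p G (cup a b) (g, h, k) = cobd1 p G a (g, h) * b k - a g * cobd1 p G b (h, k) := by
  simp only [cobd2, cobd1, cup, AddMonoidHom.coe_mk, ZeroHom.coe_mk, ContinuousMap.coe_mk]
  ring

/-- The 2-cochain attached to a defining system is a cocycle. -/
theorem IsDefiningSystem.masseyCochain_mem {n : ℕ} {α : Fin n → H1 p G}
    {a : Fin (n + 1) → Fin (n + 1) → C(G, ZMod p)} (ha : IsDefiningSystem α a) :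
    masseyCochain a ∈ (cobd2 p G).ker := by
  rw [AddMonoidHom.mem_ker]
  ext ⟨g, h, k⟩
  have h1 : ∀ r ∈ Finset.Ioo 0 (Fin.last n), cobd2 p G (cup (a 0 r) (a r (Fin.last n))) (g, h, k) =
      (∑ s ∈ Finset.Ioo 0 r, a 0 s g * a s r h * a r (Fin.last n) k) -
      ∑ s ∈ Finset.Ioo r (Fin.last n), a 0 r g * a r s h * a s (Fin.last n) k := by
    intro r hr
    rw [Finset.mem_Ioo] at hr
    rw [cobd2_cup, ha.cobd 0 r hr.1 (fun e => hr.2.ne (congrArg Prod.snd e)),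
      ha.cobd r _ hr.2 (fun e => hr.1.ne' (congrArg Prod.fst e))]
    simp [cup, ContinuousMap.sum_apply, Finset.sum_mul, Finset.mul_sum, mul_assoc]
  rw [masseyCochain, map_sum, ContinuousMap.sum_apply, Finset.sum_congr rfl h1,
    Finset.sum_sub_distrib, ContinuousMap.zero_apply, sub_eq_zero]
  refine Finset.sum_comm' fun x y => ?_
  simp only [Finset.mem_Ioo]
  exact ⟨fun h => ⟨⟨h.2.2, h.1.2⟩, h.2.1, h.2.2.trans h.1.2⟩,
    fun h => ⟨⟨h.2.1.trans h.1.1, h.1.2⟩, h.2.1, h.1.1⟩⟩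

/-- The value in `H²(G, 𝔽_p)` of a defining system. -/
def IsDefiningSystem.value {n : ℕ} {α : Fin n → H1 p G}
    {a : Fin (n + 1) → Fin (n + 1) → C(G, ZMod p)} (ha : IsDefiningSystem α a) : H2 p G :=
  QuotientAddGroup.mk ⟨masseyCochain a, ha.masseyCochain_mem⟩

/-- The `n`-fold Massey product `⟨α₁, …, αₙ⟩ ⊆ H²(G, 𝔽_p)` (for `n ≥ 2`): the set of values of
all its defining systems. -/
def masseyProduct {n : ℕ} (α : Fin n → H1 p G) : Set (H2 p G) :=
  {x | ∃ (a : Fin (n + 1) → Fin (n + 1) → C(G, ZMod p)) (ha : IsDefiningSystem α a),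
    ha.value = x}

/-- A Massey product is essential if it is defined (non-empty) and does not vanish (does not
contain `0`). -/
def IsEssentialMassey {n : ℕ} (α : Fin n → H1 p G) : Prop :=
  (masseyProduct α).Nonempty ∧ (0 : H2 p G) ∉ masseyProduct α

end Cohomology

/-! ### The classes dual to the vertices -/

section Dual

variable {V : Type*} (p : ℕ) [Fact p.Prime]

open Classical in
/-- The homomorphism from the free group to `𝔽_p` sending `x` to `1` and every other generator to
`0`. -/
noncomputable def freeDual (x : V) : FreeGroup V →* Multiplicative (ZMod p) :=
  FreeGroup.lift fun y => Multiplicative.ofAdd (if y = x then 1 else 0)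

/-- The kernel of `freeDual p x`, which has index `p`. -/
noncomputable def freeDualKer (x : V) : PPowerIndexSubgroup p V :=
  ⟨(freeDual p x).ker, inferInstance, by
    have hd : Nat.card (freeDual p x).range ∣ p ^ 1 := by
      simpa using Subgroup.card_subgroup_dvd_card (freeDual p x).range
    obtain ⟨k, -, hk⟩ := (Nat.dvd_prime_pow Fact.out).1 hd
    exact ⟨k, by rw [Subgroup.index_ker, hk]⟩⟩

/-- The continuous homomorphism from the free pro-`p` group to `𝔽_p` dual to `x`. -/
noncomputable def freeProPDual (x : V) : FreeProP p V →* Multiplicative (ZMod p) :=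
  (QuotientGroup.kerLift (freeDual p x)).comp (FreeProP.proj (freeDualKer p x)).toMonoidHom

theorem continuous_freeProPDual (x : V) : Continuous (freeProPDual p x) :=
  (continuous_of_discreteTopology (f := fun z : FreeGroup V ⧸ (freeDualKer p x).1 =>
    QuotientGroup.kerLift (freeDual p x) z)).comp (FreeProP.proj (freeDualKer p x)).continuous

open Classical in
theorem freeProPDual_of (x y : V) :
    freeProPDual p x (FreeProP.of p y) = Multiplicative.ofAdd (if y = x then 1 else 0) := by
  have h : freeProPDual p x (FreeProP.of p y) = freeDual p x (FreeGroup.of y) := rfl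
  rw [h, freeDual, FreeGroup.lift_apply_of]

theorem orientedRelations_le_ker {f : ℕ} (hf : 1 ≤ f) (Γ : Digraph V) (x : V) :
    orientedRelations p (p ^ f) Γ ≤ (freeProPDual p x).ker := by
  refine Subgroup.topologicalClosure_minimal _ (Subgroup.normalClosure_le_normal ?_) ?_
  · have hq : ∀ z : Multiplicative (ZMod p), z ^ p ^ f = 1 := fun z => by
      obtain ⟨k, hk⟩ := dvd_pow_self p (Nat.one_le_iff_ne_zero.1 hf)
      have : z ^ p = 1 := by
        rw [← ofAdd_toAdd z, ← ofAdd_nsmul]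
        simp
      rw [hk, pow_mul, this, one_pow]
    rintro r (⟨y, z, -, rfl⟩ | ⟨y, z, -, rfl⟩) <;>
      simp [MonoidHom.mem_ker, mul_comm, hq]
  · exact isClosed_singleton.preimage (continuous_freeProPDual p x)

/-- The dual class `x* ∈ H¹(G, 𝔽_p)` of a vertex `x`, where `G` is the oriented pro-`p` RAAG
associated to `Γ` and `q = p ^ f`, `f ≥ 1`. -/
noncomputable def vertexDual {f : ℕ} (hf : 1 ≤ f) (Γ : Digraph V) (x : V) :
    H1 p (OrientedRAAG p (p ^ f) Γ) :=
  ⟨⟨fun g => (QuotientGroup.lift _ (freeProPDual p x)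
      (orientedRelations_le_ker p hf Γ x) g).toAdd,
    continuous_toAdd.comp ((continuous_freeProPDual p x).quotient_lift _)⟩, by
    rw [AddMonoidHom.mem_ker]
    ext ⟨g, h⟩
    simp only [cobd1, AddMonoidHom.coe_mk, ZeroHom.coe_mk, ContinuousMap.coe_mk, map_mul,
      toAdd_mul, ContinuousMap.zero_apply]
    ring⟩

open Classical in
/-- `x*` takes the value `1` at the vertex `x` and `0` at every other vertex. -/
theorem vertexDual_vertex {f : ℕ} (hf : 1 ≤ f) (Γ : Digraph V) (x y : V) :
    (vertexDual p hf Γ x).1 (OrientedRAAG.vertex p (p ^ f) Γ y) = if y = x then 1 else 0 :=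
  congrArg Multiplicative.toAdd (freeProPDual_of p x y)

end Dual

/-!
Write `q = p ^ f`. Since `G` has the same abelian quotients of exponent dividing `q` as the free
group on the vertices, `α` lifts to a homomorphism `θ : G → ℤ/q`. The power series `(1 - X) ^ θ` is
multiplicative in `θ` and well defined modulo `X ^ q`, so its coefficients form a defining system
which depends only on the difference of the indices.

A defining system with value `0` extends, by Dwyer's correspondence, to a homomorphism `ρ` from `G`
to the unipotent matrices of size `q + 1`, with the values of `α` on the superdiagonal up to sign.
Let `A`, `B`, `C` be the images of `u`, `v`, `w`. Then `A - 1` and `B - 1` are nilpotent with a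
single Jordan block, and `C - 1` vanishes on the superdiagonal. Whichever relation holds between
`v` and `w`, `C` commutes with `B`, because `(C - 1) ^ q = 0`; hence `C - 1` is a polynomial in
`B - 1` without terms of degree less than `2`. The relation between `u` and `v` places `AB - BA` in
the top right corner, so `A` commutes with `(B - 1) ^ m` for `m ≥ 2` and therefore with `C`. But
the relation `CA = A ^ (1 + q) C` then gives `(A - 1) ^ q = 0`, which is false for a single Jordan
block of size `q + 1`.
-/

/-! ### The superdiagonal filtration -/

section UpperBand

variable {R : Type*} [Semiring R] {n k l : ℕ} {M N : Matrix (Fin n) (Fin n) R}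

/-- The `k`-th step of the superdiagonal filtration of the square matrices: the matrices which
vanish below the `k`-th superdiagonal. -/
def upperBand (R : Type*) [Semiring R] (n k : ℕ) : Submodule R (Matrix (Fin n) (Fin n) R) where
  carrier := {M | ∀ i j : Fin n, (j : ℕ) < i + k → M i j = 0}
  add_mem' hM hN i j hij := by rw [Matrix.add_apply, hM i j hij, hN i j hij, add_zero]
  zero_mem' _ _ _ := rfl
  smul_mem' c M hM i j hij := by rw [Matrix.smul_apply, hM i j hij, smul_zero]

theorem upperBand_antitone : Antitone (upperBand R n) :=
  fun _ _ hkl _ hM i j hij => hM i j (by omega)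

theorem mem_upperBand_succ (hM : M ∈ upperBand R n k)
    (hdiag : ∀ i j : Fin n, (j : ℕ) = i + k → M i j = 0) : M ∈ upperBand R n (k + 1) := by
  intro i j hij
  rcases Nat.lt_succ_iff_lt_or_eq.1 hij with h | h
  exacts [hM i j h, hdiag i j h]

theorem eq_zero_of_mem_upperBand (hM : M ∈ upperBand R n k) (hk : n ≤ k) : M = 0 := by
  ext i j
  exact hM i j (by omega)

theorem mul_mem_upperBand (hM : M ∈ upperBand R n k) (hN : N ∈ upperBand R n l) :
    M * N ∈ upperBand R n (k + l) := by
  intro i j hij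
  rw [Matrix.mul_apply]
  refine Finset.sum_eq_zero fun r _ => ?_
  by_cases hr : (r : ℕ) < i + k
  · rw [hM i r hr, zero_mul]
  · rw [hN r j (by omega), mul_zero]

theorem mul_eq_zero_of_mem_upperBand (hM : M ∈ upperBand R n k) (hN : N ∈ upperBand R n l)
    (hkl : n ≤ k + l) : M * N = 0 :=
  eq_zero_of_mem_upperBand (mul_mem_upperBand hM hN) hkl

theorem mul_apply_of_mem_upperBand (hM : M ∈ upperBand R n k) (hN : N ∈ upperBand R n l)
    {i r j : Fin n} (hr : (r : ℕ) = i + k) (hj : (j : ℕ) = r + l) :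
    (M * N) i j = M i r * N r j := by
  rw [Matrix.mul_apply]
  refine Finset.sum_eq_single r (fun s _ hs => ?_) (by simp)
  have hs' : (s : ℕ) ≠ r := Fin.val_ne_of_ne hs
  by_cases h : (s : ℕ) < i + k
  · rw [hM i s h, zero_mul]
  · rw [hN s j (by omega), mul_zero]

theorem pow_mem_upperBand (hM : M ∈ upperBand R n k) (m : ℕ) : M ^ m ∈ upperBand R n (k * m) := by
  induction m with
  | zero => exact fun i j hij => Matrix.one_apply_ne (by rintro rfl; omega)
  | succ m ih => exact pow_succ M m ▸ mul_mem_upperBand ih hM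

theorem pow_mem_upperBand_self (hM : M ∈ upperBand R n 1) (m : ℕ) : M ^ m ∈ upperBand R n m := by
  simpa only [one_mul] using pow_mem_upperBand hM m

/-- A regular nilpotent upper triangular matrix: one with zero diagonal and nonzero entries on the
first superdiagonal. -/
structure IsRegularNilpotent (B : Matrix (Fin n) (Fin n) R) : Prop where
  mem_upperBand : B ∈ upperBand R n 1
  apply_ne_zero : ∀ i j : Fin n, (j : ℕ) = i + 1 → B i j ≠ 0

namespace IsRegularNilpotent

variable [NoZeroDivisors R] {B D : Matrix (Fin n) (Fin n) R}

theorem pow_apply_ne_zero [Nontrivial R] (hB : IsRegularNilpotent B) {m : ℕ} {i j : Fin n}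
    (hij : (j : ℕ) = i + m) : (B ^ m) i j ≠ 0 := by
  induction m generalizing j with
  | zero =>
    obtain rfl : j = i := Fin.ext hij
    simp
  | succ m ih =>
    let r : Fin n := ⟨i + m, by omega⟩
    have hrj : (j : ℕ) = r + 1 := by simpa [r, add_assoc] using hij
    rw [pow_succ, mul_apply_of_mem_upperBand (r := r) (pow_mem_upperBand_self hB.mem_upperBand m)
      hB.mem_upperBand rfl hrj]
    exact mul_ne_zero (ih rfl) (hB.apply_ne_zero r j hrj)

/-- Comparing the entries of `D * B = B * D` on the next superdiagonal shows that the vanishing of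
one entry of the `k`-th superdiagonal of `D` propagates to the following one. -/
theorem mem_upperBand_succ_of_commute (hB : IsRegularNilpotent B) (hD : D ∈ upperBand R n k)
    (hDB : Commute D B) (h0 : ∀ i j : Fin n, (i : ℕ) = 0 → (j : ℕ) = k → D i j = 0) :
    D ∈ upperBand R n (k + 1) := by
  refine mem_upperBand_succ hD ?_
  rintro ⟨i, hi⟩ j hij
  induction i generalizing j with
  | zero => exact h0 _ j rfl (by simpa using hij)
  | succ i ih =>
    let i' : Fin n := ⟨i, by omega⟩
    let j' : Fin n := ⟨i + k, by simp at hij; omega⟩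
    have hj : (j : ℕ) = j' + 1 := by simp [j'] at hij ⊢; omega
    have hleft : (D * B) i' j = D i' j' * B j' j :=
      mul_apply_of_mem_upperBand hD hB.mem_upperBand rfl hj
    have hright : (B * D) i' j = B i' ⟨i + 1, hi⟩ * D ⟨i + 1, hi⟩ j :=
      mul_apply_of_mem_upperBand hB.mem_upperBand hD rfl hij
    rw [hDB.eq, hright, ih _ j' rfl, zero_mul] at hleft
    exact (mul_eq_zero.1 hleft).resolve_left (hB.apply_ne_zero _ _ rfl)

variable {K : Type*} [Field K] {B X : Matrix (Fin n) (Fin n) K}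

theorem mem_span_pow_of_commute {k : ℕ} {D : Matrix (Fin n) (Fin n) K}
    (hB : IsRegularNilpotent B) (hD : D ∈ upperBand K n k) (hDB : Commute D B) :
    D ∈ Submodule.span K {Y | ∃ m, k ≤ m ∧ Y = B ^ m} := by
  by_cases hk : n ≤ k
  · rw [eq_zero_of_mem_upperBand hD hk]
    exact zero_mem _
  · let c : K := D ⟨0, by omega⟩ ⟨k, by omega⟩ / (B ^ k) ⟨0, by omega⟩ ⟨k, by omega⟩
    have hrem_comm : Commute (D - c • B ^ k) B :=
      hDB.sub_left (((Commute.refl B).pow_left k).smul_left c)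
    have hrem : D - c • B ^ k ∈ upperBand K n (k + 1) := by
      refine hB.mem_upperBand_succ_of_commute (sub_mem hD (Submodule.smul_mem _ c
        (pow_mem_upperBand_self hB.mem_upperBand k))) hrem_comm ?_
      rintro ⟨i, hi⟩ ⟨j, hj⟩ rfl rfl
      have hpow : (B ^ j) ⟨0, hi⟩ ⟨j, hj⟩ ≠ 0 := hB.pow_apply_ne_zero (by simp)
      simp only [c, Matrix.sub_apply, Matrix.smul_apply, smul_eq_mul, div_mul_cancel₀ _ hpow,
        sub_self]
    have hrem_span := mem_span_pow_of_commute hB hrem hrem_comm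
    rw [← sub_add_cancel D (c • B ^ k)]
    refine add_mem (Submodule.span_mono ?_ hrem_span)
      (Submodule.smul_mem _ c (Submodule.subset_span ⟨k, le_rfl, rfl⟩))
    rintro _ ⟨m, hm, rfl⟩
    exact ⟨m, by omega, rfl⟩
termination_by n - k

/-- The error `X * B - B * X` is killed by one further factor `B` on either side. -/
theorem commute_pow_of_sub_mem {m : ℕ} (hB : IsRegularNilpotent B)
    (hXB : X * B - B * X ∈ upperBand K n (n - 1)) (hm : 2 ≤ m) : Commute X (B ^ m) := by
  induction m, hm using Nat.le_induction with
  | base =>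
    have hleft : (X * B - B * X) * B = 0 :=
      mul_eq_zero_of_mem_upperBand hXB hB.mem_upperBand (by omega)
    have hright : B * (X * B - B * X) = 0 :=
      mul_eq_zero_of_mem_upperBand hB.mem_upperBand hXB (by omega)
    have hsum : X * B ^ 2 - B ^ 2 * X = (X * B - B * X) * B + B * (X * B - B * X) := by
      noncomm_ring
    rwa [hleft, hright, add_zero, sub_eq_zero] at hsum
  | succ m hm ih =>
    have hright : B ^ m * (X * B - B * X) = 0 :=
      mul_eq_zero_of_mem_upperBand (pow_mem_upperBand_self hB.mem_upperBand m) hXB (by omega)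
    rw [mul_sub, sub_eq_zero] at hright
    calc X * B ^ (m + 1) = B ^ m * (X * B) := by rw [pow_succ, ← mul_assoc, ih.eq, mul_assoc]
      _ = B ^ (m + 1) * X := by rw [hright, pow_succ, mul_assoc]

theorem commute_of_commute {D : Matrix (Fin n) (Fin n) K} (hB : IsRegularNilpotent B)
    (hXB : X * B - B * X ∈ upperBand K n (n - 1)) (hD : D ∈ upperBand K n 2)
    (hDB : Commute D B) : Commute X D := by
  have hspan : Submodule.span K {Y | ∃ m, 2 ≤ m ∧ Y = B ^ m} ≤
      Subalgebra.toSubmodule (Subalgebra.centralizer K {X}) := by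
    rw [Submodule.span_le]
    rintro _ ⟨m, hm, rfl⟩
    exact (Subalgebra.mem_centralizer_iff K).2 (by
      rintro _ rfl
      exact hB.commute_pow_of_sub_mem hXB hm)
  exact (Subalgebra.mem_centralizer_iff K).1 (hspan (hB.mem_span_pow_of_commute hD hDB)) X rfl

end IsRegularNilpotent

end UpperBand

/-! ### Relations between unipotent matrices -/

section UnipotentRelations

variable {R : Type*} [Ring R]

theorem unipotent_mul_eq {n : ℕ} {A M : Matrix (Fin (n + 1)) (Fin (n + 1)) R}
    (hA : A - 1 ∈ upperBand R _ 1) (hM : M ∈ upperBand R _ n) : A * M = M := by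
  have h : (A - 1) * M = 0 := mul_eq_zero_of_mem_upperBand hA hM (by omega)
  rwa [sub_mul, one_mul, sub_eq_zero] at h

theorem mul_unipotent_eq {n : ℕ} {A M : Matrix (Fin (n + 1)) (Fin (n + 1)) R}
    (hA : A - 1 ∈ upperBand R _ 1) (hM : M ∈ upperBand R _ n) : M * A = M := by
  have h : M * (A - 1) = 0 := mul_eq_zero_of_mem_upperBand hM hA le_rfl
  rwa [mul_sub, mul_one, sub_eq_zero] at h

variable {p : ℕ} [Fact p.Prime] [CharP R p] {f : ℕ}
  {A B C : Matrix (Fin (p ^ f + 1)) (Fin (p ^ f + 1)) R}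

theorem unipotent_pow_one_add (hA : A - 1 ∈ upperBand R _ 1) :
    A ^ (1 + p ^ f) = A + (A - 1) ^ p ^ f := by
  have hpow : A ^ p ^ f = 1 + (A - 1) ^ p ^ f := by
    rw [sub_pow_char_pow_of_commute p _ (Commute.one_right A), one_pow, add_sub_cancel]
  rw [pow_add, pow_one, hpow, mul_add, mul_one, unipotent_mul_eq hA (pow_mem_upperBand_self hA _)]

theorem mul_eq_of_conj (hA : A - 1 ∈ upperBand R _ 1) (hB : B - 1 ∈ upperBand R _ 1)
    (h : B * A = A ^ (1 + p ^ f) * B) : B * A = A * B + (A - 1) ^ p ^ f := by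
  rw [h, unipotent_pow_one_add hA, add_mul, mul_unipotent_eq hB (pow_mem_upperBand_self hA _)]

theorem commute_of_conj (hB : B - 1 ∈ upperBand R _ 1) (hC : C - 1 ∈ upperBand R _ 2)
    (h : B * C = C ^ (1 + p ^ f) * B) : Commute C B := by
  have hpos : 0 < p ^ f := pow_pos (Fact.out : p.Prime).pos f
  have hzero : (C - 1) ^ p ^ f = 0 :=
    eq_zero_of_mem_upperBand (pow_mem_upperBand hC (p ^ f)) (by omega)
  have hBC := mul_eq_of_conj (upperBand_antitone one_le_two hC) hB h
  rw [hzero, add_zero] at hBC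
  exact hBC.symm

end UnipotentRelations

theorem not_conj_of_regular {K : Type*} [Field K] {p : ℕ} [Fact p.Prime] [CharP K p] {f : ℕ}
    {A B C : Matrix (Fin (p ^ f + 1)) (Fin (p ^ f + 1)) K}
    (hA : IsRegularNilpotent (A - 1)) (hB : IsRegularNilpotent (B - 1))
    (hC : C - 1 ∈ upperBand K _ 2) (hAB : A * B - B * A ∈ upperBand K _ (p ^ f))
    (hCB : Commute C B) : C * A ≠ A ^ (1 + p ^ f) * C := by
  intro hCA
  have hsub : (A - 1) * (B - 1) - (B - 1) * (A - 1) = A * B - B * A := by noncomm_ring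
  have hcomm : Commute (A - 1) (C - 1) :=
    hB.commute_of_commute (hsub ▸ hAB) hC
      ((hCB.sub_left (Commute.one_left B)).sub_right (Commute.one_right _))
  have hAC : Commute A C := by
    simpa using (hcomm.add_left (Commute.one_left _)).add_right (Commute.one_right _)
  have hC1 := upperBand_antitone one_le_two hC
  have hpow : (A - 1) ^ p ^ f = 0 := by
    have h := (mul_eq_of_conj hA.mem_upperBand hC1 hCA).symm
    rwa [hAC.eq, add_eq_left] at h
  have hcorner : ((A - 1) ^ p ^ f) 0 (Fin.last _) ≠ 0 := hA.pow_apply_ne_zero (by simp)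
  exact hcorner (by rw [hpow, Matrix.zero_apply])

/-! ### Defining systems and unipotent representations -/

section Dwyer

variable {p : ℕ} {G : Type*} [TopologicalSpace G] {n : ℕ}

/-- The strictly upper triangular matrix with entries `a i j g`. -/
def strictUpper (a : Fin n → Fin n → C(G, ZMod p)) (g : G) : Matrix (Fin n) (Fin n) (ZMod p) :=
  Matrix.of fun i j => if i < j then a i j g else 0

theorem strictUpper_mem_upperBand (a : Fin n → Fin n → C(G, ZMod p)) (g : G) :
    strictUpper a g ∈ upperBand (ZMod p) n 1 :=
  fun i j hij => if_neg (by rw [Fin.lt_def]; omega)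

theorem strictUpper_mul_strictUpper_apply (a : Fin n → Fin n → C(G, ZMod p)) (g h : G)
    (i j : Fin n) :
    (strictUpper a g * strictUpper a h) i j = ∑ r ∈ Finset.Ioo i j, a i r g * a r j h := by
  simp only [Matrix.mul_apply, strictUpper, Matrix.of_apply, ite_zero_mul_ite_zero,
    ← Finset.mem_Ioo, Finset.sum_ite_mem, Finset.univ_inter]

theorem sum_cup_apply {ι : Type*} (s : Finset ι) (a b : ι → C(G, ZMod p)) (g h : G) :
    (∑ r ∈ s, cup (a r) (b r)) (g, h) = ∑ r ∈ s, a r g * b r h := by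
  simp only [ContinuousMap.sum_apply, cup, ContinuousMap.coe_mk]

variable [Group G] [IsTopologicalGroup G]

theorem cobd1_apply (a : C(G, ZMod p)) (g h : G) : cobd1 p G a (g, h) = a h - a (g * h) + a g :=
  rfl

/-- An array of cochains satisfying the equations of a defining system at every entry above the
diagonal, including the top right corner. -/
def IsCompleteDefiningSystem (a : Fin n → Fin n → C(G, ZMod p)) : Prop :=
  ∀ i j, i < j → cobd1 p G (a i j) = ∑ r ∈ Finset.Ioo i j, cup (a i r) (a r j)

theorem exists_isCompleteDefiningSystem_of_zero_mem {α : Fin n → H1 p G} (hn : 2 ≤ n)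
    (h0 : (0 : H2 p G) ∈ masseyProduct α) :
    ∃ a : Fin (n + 1) → Fin (n + 1) → C(G, ZMod p), IsCompleteDefiningSystem a ∧
      ∀ i : Fin n, a i.castSucc i.succ = α i := by
  obtain ⟨a, ha, hval⟩ := h0
  rw [IsDefiningSystem.value, QuotientAddGroup.eq_zero_iff, AddSubgroup.mem_addSubgroupOf] at hval
  obtain ⟨b, hb⟩ := hval
  let a' : Fin (n + 1) → Fin (n + 1) → C(G, ZMod p) := Function.update a 0
    (Function.update (a 0) (Fin.last n) b)
  have hcorner : a' 0 (Fin.last n) = b := by simp [a']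
  have hne : ∀ i j, (i, j) ≠ (0, Fin.last n) → a' i j = a i j := by
    intro i j hij
    by_cases hi : i = 0
    · subst hi
      have hj : j ≠ Fin.last n := fun h => hij (by rw [h])
      simp [a', hj]
    · simp [a', hi]
  refine ⟨a', fun i j hij => ?_, fun i => ?_⟩
  · have hsum : ∑ r ∈ Finset.Ioo i j, cup (a' i r) (a' r j) =
        ∑ r ∈ Finset.Ioo i j, cup (a i r) (a r j) := by
      refine Finset.sum_congr rfl fun r hr => ?_
      obtain ⟨hir, hrj⟩ := Finset.mem_Ioo.1 hr
      rw [hne i r fun h => (hrj.trans_le (Fin.le_last j)).ne (Prod.mk.inj h).2,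
        hne r j fun h => ((Fin.zero_le i).trans_lt hir).ne' (Prod.mk.inj h).1]
    rw [hsum]
    by_cases h : (i, j) = (0, Fin.last n)
    · obtain ⟨rfl, rfl⟩ := Prod.mk.inj h
      rw [hcorner]
      exact hb
    · rw [hne i j h]
      exact ha.cobd i j hij h
  · rw [hne _ _ ?_, ha.diag]
    intro h
    simp only [Prod.mk.injEq, Fin.ext_iff, Fin.val_castSucc, Fin.val_zero, Fin.val_succ,
      Fin.val_last] at h
    omega

namespace IsCompleteDefiningSystem

variable {a : Fin n → Fin n → C(G, ZMod p)}

theorem one_sub_strictUpper_mul (ha : IsCompleteDefiningSystem a) (g h : G) :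
    1 - strictUpper a (g * h) = (1 - strictUpper a g) * (1 - strictUpper a h) := by
  suffices hadd : strictUpper a g * strictUpper a h =
      strictUpper a h - strictUpper a (g * h) + strictUpper a g by
    rw [sub_mul, one_mul, mul_sub, mul_one, hadd]
    abel
  ext i j
  rw [strictUpper_mul_strictUpper_apply]
  by_cases hij : i < j
  · have hcobd := DFunLike.congr_fun (ha i j hij) (g, h)
    rw [cobd1_apply, sum_cup_apply] at hcobd
    simp only [strictUpper, Matrix.add_apply, Matrix.sub_apply, Matrix.of_apply, if_pos hij, hcobd]
  · simp only [strictUpper, Matrix.add_apply, Matrix.sub_apply, Matrix.of_apply, if_neg hij,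
      Finset.Ioo_eq_empty hij, Finset.sum_empty, sub_zero, add_zero]

theorem one_sub_strictUpper_one (ha : IsCompleteDefiningSystem a) : 1 - strictUpper a 1 = 1 := by
  have hunit : IsUnit (1 - strictUpper a 1) := IsNilpotent.isUnit_one_sub
    ⟨n, eq_zero_of_mem_upperBand
      (pow_mem_upperBand_self (strictUpper_mem_upperBand a 1) n) le_rfl⟩
  refine (IsIdempotentElem.iff_eq_one_of_isUnit hunit).1 ?_
  rw [IsIdempotentElem, ← ha.one_sub_strictUpper_mul, mul_one]

/-- The representation by upper unitriangular matrices attached to a complete defining system. -/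
def unipotentRep (ha : IsCompleteDefiningSystem a) : G →* Matrix (Fin n) (Fin n) (ZMod p) where
  toFun g := 1 - strictUpper a g
  map_one' := ha.one_sub_strictUpper_one
  map_mul' := ha.one_sub_strictUpper_mul

theorem unipotentRep_sub_one (ha : IsCompleteDefiningSystem a) (g : G) :
    ha.unipotentRep g - 1 = -strictUpper a g :=
  sub_sub_cancel_left 1 (strictUpper a g)

theorem unipotentRep_sub_one_mem (ha : IsCompleteDefiningSystem a) (g : G) :
    ha.unipotentRep g - 1 ∈ upperBand (ZMod p) n 1 := by
  rw [unipotentRep_sub_one]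
  exact neg_mem (strictUpper_mem_upperBand a g)

theorem unipotentRep_sub_one_apply (ha : IsCompleteDefiningSystem a) (g : G) {i j : Fin n}
    (hij : i < j) : (ha.unipotentRep g - 1) i j = -a i j g := by
  rw [unipotentRep_sub_one, Matrix.neg_apply, strictUpper, Matrix.of_apply, if_pos hij]

end IsCompleteDefiningSystem

/-- One half of Dwyer's correspondence between defining systems and unipotent representations. -/
theorem exists_unipotentRep_of_zero_mem_masseyProduct {α : Fin n → H1 p G} (hn : 2 ≤ n)
    (h0 : (0 : H2 p G) ∈ masseyProduct α) :
    ∃ ρ : G →* Matrix (Fin (n + 1)) (Fin (n + 1)) (ZMod p),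
      (∀ g, ρ g - 1 ∈ upperBand (ZMod p) (n + 1) 1) ∧
      ∀ g (i : Fin n), (ρ g - 1) i.castSucc i.succ = -(α i).1 g := by
  obtain ⟨a, ha, hdiag⟩ := exists_isCompleteDefiningSystem_of_zero_mem hn h0
  refine ⟨ha.unipotentRep, ha.unipotentRep_sub_one_mem, fun g i => ?_⟩
  rw [ha.unipotentRep_sub_one_apply g Fin.castSucc_lt_succ, hdiag]

end Dwyer

/-! ### Toeplitz defining systems -/

section Toeplitz

variable {p : ℕ} {G : Type*} [Group G] [TopologicalSpace G] [IsTopologicalGroup G]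

theorem sum_Ioo_sub_sub {M : Type*} [AddCommMonoid M] {n : ℕ} (F : ℕ → ℕ → M) (i j : Fin n) :
    ∑ r ∈ Finset.Ioo i j, F (r - i) (j - r) =
      ∑ m ∈ Finset.Ioo 0 ((j : ℕ) - i), F m (j - i - m) := by
  refine Finset.sum_bij (fun r _ => (r : ℕ) - i) ?_ ?_ ?_ ?_
  · intro r hr
    rw [Finset.mem_Ioo, Fin.lt_def, Fin.lt_def] at hr
    rw [Finset.mem_Ioo]
    omega
  · intro r hr s hs hrs
    rw [Finset.mem_Ioo, Fin.lt_def, Fin.lt_def] at hr hs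
    exact Fin.ext (by omega)
  · intro m hm
    rw [Finset.mem_Ioo] at hm
    refine ⟨⟨i + m, by omega⟩, ?_, by simp⟩
    rw [Finset.mem_Ioo, Fin.lt_def, Fin.lt_def]
    exact ⟨by simp; omega, by simp; omega⟩
  · intro r hr
    rw [Finset.mem_Ioo, Fin.lt_def, Fin.lt_def] at hr
    congr 1
    omega

theorem isDefiningSystem_toeplitz {n : ℕ} {α : H1 p G} {c : ℕ → C(G, ZMod p)} (hc1 : c 1 = α)
    (hc : ∀ k, 0 < k → k < n →
      cobd1 p G (c k) = ∑ m ∈ Finset.Ioo 0 k, cup (c m) (c (k - m))) :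
    IsDefiningSystem (fun _ : Fin n => α) fun i j => c (j - i) where
  diag i := by
    rw [Fin.val_succ, Fin.val_castSucc, Nat.add_sub_cancel_left, hc1]
  cobd i j hij hne := by
    rw [Fin.lt_def] at hij
    have hlt : (j : ℕ) - i < n := by
      by_contra hle
      exact hne (Prod.ext (Fin.ext (show (i : ℕ) = 0 by omega))
        (Fin.ext (show (j : ℕ) = n by omega)))
    rw [hc _ (by omega) hlt, sum_Ioo_sub_sub fun m l => cup (c m) (c l)]

end Toeplitz

section BinomialSystem

open Polynomial

variable {p : ℕ} [Fact p.Prime] {f : ℕ}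

theorem coeff_one_sub_X_pow_mod (m : ℕ) {k : ℕ} (hk : k < p ^ f) :
    ((1 - X : (ZMod p)[X]) ^ (m % p ^ f)).coeff k = ((1 - X : (ZMod p)[X]) ^ m).coeff k := by
  have hdvd : (X : (ZMod p)[X]) ^ p ^ f ∣ (1 - X) ^ (p ^ f * (m / p ^ f)) - 1 := by
    have h := sub_dvd_pow_sub_pow (1 - X ^ p ^ f : (ZMod p)[X]) 1 (m / p ^ f)
    rwa [sub_sub_cancel_left, neg_dvd, one_pow, ← one_pow (p ^ f), ← sub_pow_char_pow, one_pow,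
      ← pow_mul] at h
  have hsub := X_pow_dvd_iff.1 (hdvd.mul_left ((1 - X) ^ (m % p ^ f))) k hk
  rw [mul_sub, mul_one, ← pow_add, Nat.mod_add_div, coeff_sub, sub_eq_zero] at hsub
  exact hsub.symm

/-- The negated coefficient of `X ^ k` in `(1 - X) ^ t`, which for `k < p ^ f` depends only on `t`
modulo `p ^ f`. The sign makes `binomialCochain p f 1 t` the reduction of `t`. -/
noncomputable def binomialCochain (p f k : ℕ) (t : ZMod (p ^ f)) : ZMod p :=
  -((1 - X : (ZMod p)[X]) ^ t.val).coeff k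

theorem binomialCochain_one (t : ZMod (p ^ f)) : binomialCochain p f 1 t = (t.val : ZMod p) := by
  have hcoeff (m : ℕ) : ((1 - X : (ZMod p)[X]) ^ m).coeff 1 = -m := by
    induction m with
    | zero => simp [coeff_one]
    | succ m ih => simp [pow_succ, mul_coeff_one, ih, coeff_zero_eq_eval_zero, coeff_one]
  rw [binomialCochain, hcoeff, neg_neg]

theorem sum_antidiagonal_eq_add_sum_Ioo {M : Type*} [AddCommMonoid M] (F : ℕ → ℕ → M) {k : ℕ}
    (hk : 0 < k) :
    ∑ x ∈ Finset.HasAntidiagonal.antidiagonal k, F x.1 x.2 =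
      F 0 k + F k 0 + ∑ m ∈ Finset.Ioo 0 k, F m (k - m) := by
  rw [Finset.Nat.sum_antidiagonal_eq_sum_range_succ F, Finset.sum_range_succ, Nat.sub_self,
    Finset.range_eq_Ico, ← Finset.add_sum_Ioo_eq_sum_Ico hk, Nat.sub_zero]
  abel

theorem binomialCochain_cobd {k : ℕ} (hk0 : 0 < k) (hk : k < p ^ f) (s t : ZMod (p ^ f)) :
    binomialCochain p f k t - binomialCochain p f k (s + t) + binomialCochain p f k s =
      ∑ m ∈ Finset.Ioo 0 k, binomialCochain p f m s * binomialCochain p f (k - m) t := by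
  have : NeZero (p ^ f) := ⟨by omega⟩
  have hzero (m : ℕ) : ((1 - X : (ZMod p)[X]) ^ m).coeff 0 = 1 := by
    simp [coeff_zero_eq_eval_zero]
  have hadd := coeff_one_sub_X_pow_mod (p := p) (s.val + t.val) hk
  rw [← ZMod.val_add, pow_add, coeff_mul, sum_antidiagonal_eq_add_sum_Ioo (fun m l =>
    ((1 - X : (ZMod p)[X]) ^ s.val).coeff m * ((1 - X : (ZMod p)[X]) ^ t.val).coeff l) hk0,
    hzero, hzero, one_mul, mul_one] at hadd
  simp only [binomialCochain, hadd, neg_mul_neg]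
  ring

theorem masseyProduct_nonempty_of_lift {G : Type*} [Group G] [TopologicalSpace G]
    [IsTopologicalGroup G] (α : H1 p G) (θ : G →ₜ* Multiplicative (ZMod (p ^ f)))
    (hθ : ∀ g, α.1 g = ((θ g).toAdd.val : ZMod p)) :
    (masseyProduct fun _ : Fin (p ^ f) => α).Nonempty := by
  let c : ℕ → C(G, ZMod p) := fun k =>
    ⟨fun g => binomialCochain p f k (θ g).toAdd, (continuous_of_discreteTopology
      (f := fun t : Multiplicative (ZMod (p ^ f)) => binomialCochain p f k t.toAdd)).comp
        θ.continuous_toFun⟩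
  refine ⟨_, _, isDefiningSystem_toeplitz (c := c) ?_ fun k hk0 hk => ?_, rfl⟩
  · ext g
    exact (binomialCochain_one _).trans (hθ g).symm
  · ext ⟨g, h⟩
    rw [cobd1_apply, sum_cup_apply]
    simp only [c, ContinuousMap.coe_mk, map_mul, toAdd_mul]
    exact binomialCochain_cobd hk0 hk _ _

end BinomialSystem

/-! ### Homomorphisms from oriented pro-`p` RAAGs to finite `p`-groups -/

namespace PPowerIndexSubgroup

variable {p : ℕ} [Fact p.Prime] {V : Type*}

/-- The kernel of a homomorphism from the free group to a finite `p`-group. -/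
def ker {P : Type*} [Group P] [Finite P] (hP : IsPGroup p P) (φ : FreeGroup V →* P) :
    PPowerIndexSubgroup p V :=
  ⟨φ.ker, inferInstance, by
    rw [Subgroup.index_ker]
    exact IsPGroup.iff_card.1 (hP.to_subgroup φ.range)⟩

theorem exists_le_le (M N : PPowerIndexSubgroup p V) :
    ∃ L : PPowerIndexSubgroup p V, L.1 ≤ M.1 ∧ L.1 ≤ N.1 := by
  obtain ⟨a, ha⟩ := M.2.2
  obtain ⟨b, hb⟩ := N.2.2
  have hcard : Nat.card ((FreeGroup V ⧸ M.1) × (FreeGroup V ⧸ N.1)) = p ^ (a + b) := by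
    rw [Nat.card_prod, ← Subgroup.index_eq_card, ← Subgroup.index_eq_card, ha, hb, pow_add]
  have : Finite ((FreeGroup V ⧸ M.1) × (FreeGroup V ⧸ N.1)) := by
    refine Nat.finite_of_card_ne_zero ?_
    rw [hcard]
    exact pow_ne_zero _ (Fact.out : p.Prime).ne_zero
  refine ⟨ker (IsPGroup.of_card hcard) ((QuotientGroup.mk' M.1).prod (QuotientGroup.mk' N.1)), ?_⟩
  simp only [ker, MonoidHom.ker_prod, QuotientGroup.ker_mk']
  exact ⟨inf_le_left, inf_le_right⟩

instance : Nonempty (PPowerIndexSubgroup p V) := ⟨⟨⊤, inferInstance, 0, by simp⟩⟩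

theorem exists_forall_le (s : Finset (PPowerIndexSubgroup p V)) :
    ∃ L : PPowerIndexSubgroup p V, ∀ N ∈ s, L.1 ≤ N.1 :=
  Directed.finset_le (r := fun M N : PPowerIndexSubgroup p V => N.1 ≤ M.1) (f := id) exists_le_le s

end PPowerIndexSubgroup

namespace FreeProP

variable {p : ℕ} [Fact p.Prime] {V : Type*}

theorem denseRange_ofFreeGroup : DenseRange (ofFreeGroup p V) := by
  intro x
  rw [mem_closure_iff]
  rintro _ ⟨U, hU, rfl⟩ hx
  obtain ⟨s, W, hW, hWU⟩ := isOpen_pi_iff.1 hU x.1 hx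
  obtain ⟨L, hL⟩ := PPowerIndexSubgroup.exists_forall_le s
  obtain ⟨z, hz⟩ := QuotientGroup.mk_surjective (x.1 L)
  refine ⟨ofFreeGroup p V z, hWU fun N hN => ?_, z, rfl⟩
  have hproj : x.1 N = (ofFreeGroup p V z).1 N := by
    rw [← x.2 L N (hL N hN), ← hz]
    rfl
  exact hproj ▸ (hW N hN).2

variable {P : Type*} [Group P] [Finite P] [TopologicalSpace P]

/-- The extension of a map `V → P` to a finite `p`-group `P` to a continuous homomorphism on the
free pro-`p` group. -/
def lift (hP : IsPGroup p P) (φ : V → P) : FreeProP p V →ₜ* P where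
  toMonoidHom := (QuotientGroup.kerLift (FreeGroup.lift φ)).comp
    (proj (PPowerIndexSubgroup.ker hP (FreeGroup.lift φ))).toMonoidHom
  continuous_toFun := (continuous_of_discreteTopology
    (f := fun z : FreeGroup V ⧸ (PPowerIndexSubgroup.ker hP (FreeGroup.lift φ)).1 =>
      QuotientGroup.kerLift (FreeGroup.lift φ) z)).comp (proj _).continuous

theorem lift_of (hP : IsPGroup p P) (φ : V → P) (x : V) : lift hP φ (of p x) = φ x :=
  FreeGroup.lift_apply_of

end FreeProP

namespace OrientedRAAG

variable {p q : ℕ} {V : Type*} {Γ : Digraph V}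

theorem mk_eq_one_of_mem {r : FreeProP p V} (hr : r ∈ orientedRelators p q Γ) :
    (QuotientGroup.mk r : OrientedRAAG p q Γ) = 1 :=
  (QuotientGroup.eq_one_iff r).2
    (Subgroup.le_topologicalClosure _ (Subgroup.subset_normalClosure hr))

theorem commute_vertex {x y : V} (h : Γ.IsUndirectedEdge x y) :
    Commute (vertex p q Γ x) (vertex p q Γ y) := by
  have hrel : vertex p q Γ x * vertex p q Γ y * (vertex p q Γ x)⁻¹ * (vertex p q Γ y)⁻¹ = 1 :=
    mk_eq_one_of_mem (Or.inl ⟨x, y, h, rfl⟩)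
  rwa [mul_inv_eq_one, mul_inv_eq_iff_eq_mul] at hrel

theorem vertex_mul_vertex {x y : V} (h : Γ.IsDirectedEdge x y) :
    vertex p q Γ y * vertex p q Γ x = vertex p q Γ x ^ (1 + q) * vertex p q Γ y := by
  have hrel : vertex p q Γ y * vertex p q Γ x * (vertex p q Γ y)⁻¹ * (vertex p q Γ x)⁻¹ *
      (vertex p q Γ x ^ q)⁻¹ = 1 :=
    mk_eq_one_of_mem (Or.inr ⟨x, y, h, rfl⟩)
  rwa [mul_inv_eq_one, mul_inv_eq_iff_eq_mul, mul_inv_eq_iff_eq_mul, ← pow_succ, add_comm q 1]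
    at hrel

variable [Fact p.Prime] {P : Type*} [Group P] [TopologicalSpace P] [T2Space P]

theorem hom_ext {φ ψ : OrientedRAAG p q Γ →ₜ* P}
    (h : ∀ x, φ (vertex p q Γ x) = ψ (vertex p q Γ x)) : φ = ψ := by
  let π : FreeProP p V →* OrientedRAAG p q Γ := QuotientGroup.mk' _
  have hfree : (φ.toMonoidHom.comp π).comp (FreeProP.ofFreeGroup p V) =
      (ψ.toMonoidHom.comp π).comp (FreeProP.ofFreeGroup p V) :=
    FreeGroup.ext_hom _ _ h
  have hcomp : φ ∘ π = ψ ∘ π := FreeProP.denseRange_ofFreeGroup.equalizer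
    (φ.continuous_toFun.comp continuous_quotient_mk')
    (ψ.continuous_toFun.comp continuous_quotient_mk')
    (congrArg DFunLike.coe hfree)
  exact DFunLike.coe_injective ((QuotientGroup.mk'_surjective _).injective_comp_right hcomp)

variable [Finite P]

theorem exists_lift (hP : IsPGroup p P) {φ : V → P}
    (hcomm : ∀ x y, Γ.IsUndirectedEdge x y → Commute (φ x) (φ y))
    (hconj : ∀ x y, Γ.IsDirectedEdge x y → φ y * φ x = φ x ^ (1 + q) * φ y) :
    ∃ ψ : OrientedRAAG p q Γ →ₜ* P, ∀ x, ψ (vertex p q Γ x) = φ x := by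
  have hker : orientedRelations p q Γ ≤ (FreeProP.lift hP φ).toMonoidHom.ker := by
    refine Subgroup.topologicalClosure_minimal _ (Subgroup.normalClosure_le_normal ?_)
      (isClosed_singleton.preimage (FreeProP.lift hP φ).continuous_toFun)
    rintro r (⟨x, y, h, rfl⟩ | ⟨x, y, h, rfl⟩) <;>
      simp only [SetLike.mem_coe, MonoidHom.mem_ker, map_mul, map_inv, map_pow,
        ContinuousMonoidHom.coe_toMonoidHom, MonoidHom.coe_coe, FreeProP.lift_of]
    · rw [(hcomm x y h).eq, mul_inv_cancel_right, mul_inv_cancel]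
    · rw [hconj x y h, mul_inv_cancel_right, add_comm, pow_succ, mul_inv_cancel_right,
        mul_inv_cancel]
  exact ⟨⟨QuotientGroup.lift _ _ hker, (FreeProP.lift hP φ).continuous_toFun.quotient_lift _⟩,
    FreeProP.lift_of hP φ⟩

end OrientedRAAG

section LiftH1

variable {p : ℕ} {G : Type*} [Group G] [TopologicalSpace G] [IsTopologicalGroup G]

theorem H1.map_mul (α : H1 p G) (g h : G) : α.1 (g * h) = α.1 g + α.1 h := by
  have hcobd := DFunLike.congr_fun (AddMonoidHom.mem_ker.1 α.2) (g, h)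
  rw [cobd1_apply, ContinuousMap.zero_apply] at hcobd
  linear_combination -hcobd

/-- A class in `H¹(G, 𝔽_p)` as a continuous homomorphism. -/
def H1.toHom (α : H1 p G) : G →ₜ* Multiplicative (ZMod p) where
  toMonoidHom := MonoidHom.mk' (fun g => Multiplicative.ofAdd (α.1 g)) fun g h =>
    congrArg Multiplicative.ofAdd (α.map_mul g h)
  continuous_toFun := continuous_ofAdd.comp α.1.continuous

theorem OrientedRAAG.exists_lift_H1 [Fact p.Prime] {f : ℕ} (hf : 1 ≤ f) {V : Type*}
    {Γ : Digraph V} (α : H1 p (OrientedRAAG p (p ^ f) Γ)) :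
    ∃ θ : OrientedRAAG p (p ^ f) Γ →ₜ* Multiplicative (ZMod (p ^ f)),
      ∀ g, α.1 g = ((θ g).toAdd.val : ZMod p) := by
  have : NeZero (p ^ f) := ⟨pow_ne_zero f (Fact.out : p.Prime).ne_zero⟩
  have hP : IsPGroup p (Multiplicative (ZMod (p ^ f))) :=
    IsPGroup.of_card ((Nat.card_congr Multiplicative.toAdd).trans (Nat.card_zmod _))
  have hpow (z : Multiplicative (ZMod (p ^ f))) : z ^ p ^ f = 1 := by
    rw [← ofAdd_toAdd z, ← ofAdd_nsmul, ZModModule.char_nsmul_eq_zero, ofAdd_zero]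
  obtain ⟨θ, hθ⟩ := exists_lift (Γ := Γ) (q := p ^ f) hP
    (φ := fun x => Multiplicative.ofAdd ((α.1 (vertex p _ Γ x)).val : ZMod (p ^ f)))
    (fun _ _ _ => Commute.all _ _)
    (fun _ _ _ => by rw [pow_add, hpow, pow_one, mul_one, mul_comm])
  let red : ZMod (p ^ f) →+* ZMod p := ZMod.castHom (dvd_pow_self p (Nat.one_le_iff_ne_zero.1 hf)) _
  let red' : Multiplicative (ZMod (p ^ f)) →ₜ* Multiplicative (ZMod p) :=
    ⟨red.toAddMonoidHom.toMultiplicative, continuous_of_discreteTopology⟩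
  have hred : α.toHom = red'.comp θ := hom_ext fun x => by
    change Multiplicative.ofAdd (α.1 (vertex p _ Γ x)) =
      Multiplicative.ofAdd (red (θ (vertex p _ Γ x)).toAdd)
    rw [hθ, toAdd_ofAdd, map_natCast, ZMod.natCast_zmod_val]
  refine ⟨θ, fun g => ?_⟩
  rw [ZMod.natCast_val]
  exact congrArg Multiplicative.toAdd (DFunLike.congr_fun hred g)

end LiftH1

/-! ### Triangles -/

section Triangle

variable {p : ℕ} [Fact p.Prime] {f : ℕ} {V : Type*} {Γ : Digraph V}

open OrientedRAAG

theorem sub_mem_upperBand_of_isJoined {R : Type*} [Ring R] [CharP R p]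
    {ρ : OrientedRAAG p (p ^ f) Γ →* Matrix (Fin (p ^ f + 1)) (Fin (p ^ f + 1)) R}
    (hρ : ∀ g, ρ g - 1 ∈ upperBand R _ 1) {x y : V} (h : Γ.IsJoined x y) :
    ρ (vertex p _ Γ x) * ρ (vertex p _ Γ y) - ρ (vertex p _ Γ y) * ρ (vertex p _ Γ x) ∈
      upperBand R _ (p ^ f) := by
  have hdirected {x y : V} (hxy : Γ.IsDirectedEdge x y) :
      ρ (vertex p _ Γ y) * ρ (vertex p _ Γ x) - ρ (vertex p _ Γ x) * ρ (vertex p _ Γ y) ∈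
        upperBand R _ (p ^ f) := by
    have hconj := congrArg ρ (vertex_mul_vertex (p := p) (q := p ^ f) hxy)
    rw [map_mul, map_mul, map_pow] at hconj
    rw [mul_eq_of_conj (hρ _) (hρ _) hconj, add_sub_cancel_left]
    exact pow_mem_upperBand_self (hρ _) _
  by_cases hxy : Γ.Adj x y <;> by_cases hyx : Γ.Adj y x
  · rw [((commute_vertex ⟨hxy, hyx⟩).map ρ).eq, sub_self]
    exact zero_mem _
  · rw [← neg_sub]
    exact neg_mem (hdirected ⟨hxy, hyx⟩)
  · exact hdirected ⟨hyx, hxy⟩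
  · exact absurd h (not_or_intro hxy hyx)

theorem zero_notMem_masseyProduct_of_triangle (hf : 1 ≤ f) {u v w : V}
    (huw : Γ.IsDirectedEdge u w) (huv : Γ.IsJoined u v)
    (hwv : Γ.IsDirectedEdge w v ∨ Γ.IsUndirectedEdge w v)
    {α : Fin (p ^ f) → H1 p (OrientedRAAG p (p ^ f) Γ)}
    (hu : ∀ i, (α i).1 (vertex p _ Γ u) ≠ 0) (hv : ∀ i, (α i).1 (vertex p _ Γ v) ≠ 0)
    (hw : ∀ i, (α i).1 (vertex p _ Γ w) = 0) : 0 ∉ masseyProduct α := by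
  intro h0
  have hq : 2 ≤ p ^ f :=
    (Fact.out : p.Prime).two_le.trans (Nat.le_self_pow (Nat.one_le_iff_ne_zero.1 hf) p)
  obtain ⟨ρ, hρ, hsuper⟩ := exists_unipotentRep_of_zero_mem_masseyProduct hq h0
  have hentry (g) (i j : Fin (p ^ f + 1)) (hij : (j : ℕ) = i + 1) :
      ∃ l, (ρ g - 1) i j = -(α l).1 g := by
    let l : Fin (p ^ f) := ⟨i, by omega⟩
    have hj : j = l.succ := Fin.ext hij
    exact ⟨l, hj ▸ hsuper g l⟩
  have hregular {x : V} (hx : ∀ i, (α i).1 (vertex p _ Γ x) ≠ 0) :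
      IsRegularNilpotent (ρ (vertex p _ Γ x) - 1) := by
    refine ⟨hρ _, fun i j hij => ?_⟩
    obtain ⟨l, hl⟩ := hentry (vertex p _ Γ x) i j hij
    exact hl ▸ neg_ne_zero.2 (hx l)
  have hC : ρ (vertex p _ Γ w) - 1 ∈ upperBand (ZMod p) _ 2 := by
    refine mem_upperBand_succ (hρ _) fun i j hij => ?_
    obtain ⟨l, hl⟩ := hentry (vertex p _ Γ w) i j hij
    rw [hl, hw, neg_zero]
  have hconj {x y : V} (hxy : Γ.IsDirectedEdge x y) :
      ρ (vertex p _ Γ y) * ρ (vertex p _ Γ x) =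
        ρ (vertex p _ Γ x) ^ (1 + p ^ f) * ρ (vertex p _ Γ y) := by
    rw [← map_mul, ← map_pow, ← map_mul, vertex_mul_vertex hxy]
  have hCB : Commute (ρ (vertex p _ Γ w)) (ρ (vertex p _ Γ v)) :=
    hwv.elim (fun h => commute_of_conj (hρ _) hC (hconj h)) fun h => (commute_vertex h).map ρ
  exact not_conj_of_regular (hregular hu) (hregular hv) hC
    (sub_mem_upperBand_of_isJoined hρ huv) hCB (hconj huw)

theorem proposition6p3_general (hf : 1 ≤ f) {u v w : V}
    (huw : Γ.IsDirectedEdge u w) (huv : Γ.IsJoined u v)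
    (hwv : Γ.IsDirectedEdge w v ∨ Γ.IsUndirectedEdge w v)
    {α : H1 p (OrientedRAAG p (p ^ f) Γ)} (hu : α.1 (vertex p _ Γ u) ≠ 0)
    (hv : α.1 (vertex p _ Γ v) ≠ 0) (hw : α.1 (vertex p _ Γ w) = 0) :
    IsEssentialMassey fun _ : Fin (p ^ f) => α := by
  obtain ⟨θ, hθ⟩ := exists_lift_H1 hf α
  exact ⟨masseyProduct_nonempty_of_lift α θ hθ, zero_notMem_masseyProduct_of_triangle hf huw huv
    hwv (fun _ => hu) (fun _ => hv) fun _ => hw⟩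

end Triangle

theorem ne_of_adj {V : Type*} {Γ : Digraph V} (hΓ : ∀ x, ¬ Γ.Adj x x) {x y : V}
    (h : Γ.Adj x y) : x ≠ y := by
  rintro rfl
  exact hΓ x h

theorem proposition6p3 {V : Type*} [Finite V] (p : ℕ) [Fact p.Prime] (f : ℕ) (hf : 1 ≤ f)
    (hf2 : p = 2 → 2 ≤ f) (Γ : Digraph V) (hΓ : ∀ x, ¬ Γ.Adj x x) (u v w : V)
    (huw : Γ.IsDirectedEdge u w) (huv : Γ.IsJoined u v)
    (hwv : Γ.IsDirectedEdge w v ∨ Γ.IsUndirectedEdge w v) :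
    IsEssentialMassey
      (fun _ : Fin (p ^ f) => vertexDual p hf Γ u + vertexDual p hf Γ v) := by
  have hne_uw : u ≠ w := ne_of_adj hΓ huw.1
  have hne_uv : u ≠ v := huv.elim (ne_of_adj hΓ) fun h => (ne_of_adj hΓ h).symm
  have hne_wv : w ≠ v := hwv.elim (fun h => ne_of_adj hΓ h.1) fun h => ne_of_adj hΓ h.1
  refine proposition6p3_general hf huw huv hwv ?_ ?_ ?_ <;>
    rw [AddSubgroup.coe_add, ContinuousMap.add_apply, vertexDual_vertex, vertexDual_vertex] <;>
    simp [hne_uw.symm, hne_uv, hne_uv.symm, hne_wv]
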